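/- Let $A$ be a commutative normed $*$-algebra: a complex commutative associative algebra, not necessarily unital, with a norm satisfying $|ab|\le|a||b|$ (not necessarily complete) and a conjugate-linear involution $a\mapsto a^*$ with $(ab)^*=b^*a^*$ (not assumed continuous). Let $A_{sa}=\{a\in A: a^*=a\}$. A linear functional $\varphi:A\to\mathbb C$ is positive if $\varphi(a^*a)\ge 0$ for all $a\in A$. A positive linear functional $\varphi$ is weakly continuous on $A_{sa}$ if for each $b\in A$ the map $a\mapsto\varphi(b^*ab)$ is continuous on $A_{sa}$. It has finite variation if there is $v\ge 0$ with $|\varphi(a)|^2\le v\,\varphi(a^*a)$ for all $a\in A$, and the infimum of all such $v$ is then its variation. The set $S(A)$ of states on $A$ consists of the positive linear functionals on $A$ which are weakly continuous on $A_{sa}$ and have finite variation equal to $1$. Let $\Delta^*_{bsa}(A)$ be the set of non-zero linear functionals $\tau:A\to\mathbb C$ such that $\tau(ab)=\tau(a)\tau(b)$ and $\tau(a^*)=\overline{\tau(a)}$ for all $a,b\in A$, and such that $\tau$ is bounded on $A_{sa}$, i.e. $|\tau(a)|\le C|a|$ for all $a\in A_{sa}$ and some constant $C$. Equip it with the weak$^*$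 topology, i.e. the weakest topology for which the functions $\widehat a:\tau\mapsto\tau(a)$ $(a\in A_{sa})$ are continuous. Let $M_1(\Delta^*_{bsa}(A))$ be the set of inner regular Borel probability measures on $\Delta^*_{bsa}(A)$, that is, Borel probability measures $\mu$ with $\mu(\omega)=\sup\{\mu(K):K\subset\omega\text{ compact}\}$ for every Borel set $\omega$. For $a\in A$ write $\widehat a(\tau)=\tau(a)$. Then for every $\mu\in M_1(\Delta^*_{bsa}(A))$ each $\widehat a$ $(a\in A)$ is $\mu$-integrable, and the formula $$\psi(a)=\int\widehat a\,d\mu\qquad(a\in A)$$ establishes an affine bijection $\mu\mapsto\psi$ from $M_1(\Delta^*_{bsa}(A))$ onto $S(A)$. -/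

import Mathlib

open MeasureTheory
open scoped ComplexOrder NNReal

namespace AbstractBochner

/-- `φ` is a positive linear functional: `φ (a* a) ≥ 0` for all `a`. (In `ComplexOrder`, `0 ≤ z`
means that `z` is real and nonnegative.) -/
def IsPositive {A : Type*} [NonUnitalNormedCommRing A] [StarRing A] [NormedSpace ℂ A]
    (φ : A →ₗ[ℂ] ℂ) : Prop :=
  ∀ a : A, 0 ≤ φ (star a * a)

/-- `φ` is weakly continuous on the set `A_sa` of self-adjoint elements: for each `b`, the map
`a ↦ φ (b* a b)` is continuous on `A_sa`. -/
def IsWeaklyContinuousOnSA {A : Type*} [NonUnitalNormedCommRing A] [StarRing A] [NormedSpace ℂ A]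
    (φ : A →ₗ[ℂ] ℂ) : Prop :=
  ∀ b : A, Continuous fun a : selfAdjoint A => φ (star b * (a : A) * b)

/-- The set of constants `v ≥ 0` with `|φ a|² ≤ v φ (a* a)` for all `a`. -/
def variationBounds {A : Type*} [NonUnitalNormedCommRing A] [StarRing A] [NormedSpace ℂ A]
    (φ : A →ₗ[ℂ] ℂ) : Set ℝ :=
  {v : ℝ | 0 ≤ v ∧ ∀ a : A, ‖φ a‖ ^ 2 ≤ v * (φ (star a * a)).re}

/-- `φ` has finite variation. -/
def HasFiniteVariation {A : Type*} [NonUnitalNormedCommRing A] [StarRing A] [NormedSpace ℂ A]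
    (φ : A →ₗ[ℂ] ℂ) : Prop :=
  (variationBounds φ).Nonempty

/-- The variation of a positive linear functional of finite variation. -/
noncomputable def variation {A : Type*} [NonUnitalNormedCommRing A] [StarRing A] [NormedSpace ℂ A]
    (φ : A →ₗ[ℂ] ℂ) : ℝ :=
  sInf (variationBounds φ)

/-- The set `S(A)` of states: the positive linear functionals that are weakly continuous on `A_sa`
and have finite variation, equal to `1`. -/
def States (A : Type*) [NonUnitalNormedCommRing A] [StarRing A] [NormedSpace ℂ A] :
    Set (A →ₗ[ℂ] ℂ) :=
  {φ | IsPositive φ ∧ IsWeaklyContinuousOnSA φ ∧ HasFiniteVariation φ ∧ variation φ = 1}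

/-- The space `Δ*_bsa(A)` of Hermitian multiplicative (hence nonzero) linear functionals on `A`
that are bounded on `A_sa`. -/
structure BsaCharacter (A : Type*) [NonUnitalNormedCommRing A] [StarRing A]
    [NormedSpace ℂ A] where
  /-- the underlying linear functional -/
  toLin : A →ₗ[ℂ] ℂ
  ne_zero : toLin ≠ 0
  map_mul : ∀ a b : A, toLin (a * b) = toLin a * toLin b
  map_star : ∀ a : A, toLin (star a) = star (toLin a)
  bounded_sa : ∃ C : ℝ, ∀ a : selfAdjoint A, ‖toLin (a : A)‖ ≤ C * ‖(a : A)‖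

/-- The Gelfand transform `â` of `a`, as a function on `Δ*_bsa(A)`. -/
def gelfandHat {A : Type*} [NonUnitalNormedCommRing A] [StarRing A] [NormedSpace ℂ A] (a : A) :
    BsaCharacter A → ℂ :=
  fun τ => τ.toLin a

/-- `Δ*_bsa(A)` carries the weak* topology of the dual of the real normed space `A_sa`, that is, the
weakest topology making the evaluations at the elements of `A_sa` continuous. -/
noncomputable instance BsaCharacter.instTopologicalSpace (A : Type*) [NonUnitalNormedCommRing A] [StarRing A]
    [NormedSpace ℂ A] : TopologicalSpace (BsaCharacter A) :=
  TopologicalSpace.induced (fun τ (a : selfAdjoint A) => gelfandHat (a : A) τ) inferInstance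

/-- `Δ*_bsa(A)` carries its Borel sigma-algebra. -/
noncomputable instance BsaCharacter.instMeasurableSpace (A : Type*) [NonUnitalNormedCommRing A] [StarRing A]
    [NormedSpace ℂ A] : MeasurableSpace (BsaCharacter A) :=
  borel (BsaCharacter A)

/-- The set `M₁(Ω)` of inner regular Borel probability measures on `Ω`. Inner regularity means
`μ ω = sup {μ K : K ⊆ ω compact}` for every Borel set `ω`. -/
def M₁ (Ω : Type*) [TopologicalSpace Ω] [MeasurableSpace Ω] : Set (Measure Ω) :=
  {μ | IsProbabilityMeasure μ ∧ μ.InnerRegular}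

end AbstractBochner

/-! From a state to a measure: by iterated Cauchy–Schwarz, weak continuity makes left multiplication
by `a` bounded by `√‖star a * a‖` for the semi-inner product `φ (b* c)`. This gives a GNS
representation `π` (`exists_gns`). Finite variation makes `φ` a bounded functional on the
completion, and its Riesz vector `ξ` is cyclic with `‖ξ‖² = 1`, the variation. The unital C⋆-algebra
generated by `π(A)` is commutative, hence some `C(X)`, and the vector functional of `ξ` is a regular
probability measure on `X`. Each point of `X` where `A` does not vanish is a character. The other
points form a null set, because elements of `A` approximate `1` in mean square. Pushing the measure
forward gives `exists_measure_of_mem_states`.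

From a measure to a state: the variation is at most `1` by Cauchy–Schwarz. It is at least `1` by
inner regularity: on each compact set of characters, elements of `A` approximate the constant `1`
(`measureReal_le_of_mem_variationBounds`).

Injectivity: characters embed in a compact product of discs, where Stone–Weierstrass applies to
Gelfand transforms plus constants (`measure_ext_of_integral_gelfandHat`). -/

namespace AbstractBochner

open scoped InnerProductSpace
open Complex UniformSpace Completion Filter Topology

/-! ### Power estimates and the GNS construction. -/

/-- If `x ^ 2 ^ k ≤ C * y ^ 2 ^ k` for all `k`, then `x ≤ y`. -/
lemma le_of_forall_pow_two_pow_le {x y C : ℝ} (hy : 0 ≤ y)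
    (h : ∀ k : ℕ, x ^ 2 ^ k ≤ C * y ^ 2 ^ k) : x ≤ y := by
  by_contra! hxy
  rcases hy.eq_or_lt with rfl | hy
  · have := h 0
    simp at this
    linarith
  have h1 : 1 < x / y := (one_lt_div hy).2 hxy
  obtain ⟨n, hn⟩ := pow_unbounded_of_one_lt C h1
  have h2 : C < (x / y) ^ 2 ^ n :=
    hn.trans_le (pow_le_pow_right₀ h1.le Nat.lt_two_pow_self.le)
  rw [div_pow, lt_div_iff₀ (by positivity)] at h2
  exact absurd (h n) (not_le.2 h2)

section SqIter

variable {A : Type*} [NonUnitalNormedCommRing A]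

/-- The iterated squares `a, a², a⁴, …`. -/
def sqIter (a : A) : ℕ → A
  | 0 => a
  | n + 1 => sqIter a n * sqIter a n

lemma norm_sqIter_le (a : A) (n : ℕ) : ‖sqIter a n‖ ≤ ‖a‖ ^ 2 ^ n := by
  induction n with
  | zero => simp [sqIter]
  | succ n ih =>
    calc ‖sqIter a n * sqIter a n‖ ≤ ‖sqIter a n‖ * ‖sqIter a n‖ := norm_mul_le _ _
      _ ≤ ‖a‖ ^ 2 ^ n * ‖a‖ ^ 2 ^ n := by gcongr
      _ = ‖a‖ ^ 2 ^ (n + 1) := by rw [← pow_add, pow_succ 2 n, mul_two]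

lemma isSelfAdjoint_sqIter [StarRing A] {a : A} (ha : IsSelfAdjoint a) (n : ℕ) :
    IsSelfAdjoint (sqIter a n) := by
  induction n with
  | zero => exact ha
  | succ n ih => exact ih.mul ih

end SqIter

universe u

variable {A : Type u} [NonUnitalNormedCommRing A] [StarRing A] [NormedSpace ℂ A]
  [IsScalarTower ℂ A A] [SMulCommClass ℂ A A] [StarModule ℂ A]

/-- Continuity at `0` suffices, by rescaling; the scalar is real so that `c • a` stays self-adjoint.
-/
lemma IsWeaklyContinuousOnSA.exists_bound {φ : A →ₗ[ℂ] ℂ}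
    (hφ : IsWeaklyContinuousOnSA φ)
    (b : A) : ∃ C : ℝ, ∀ a : A, IsSelfAdjoint a → ‖φ (star b * a * b)‖ ≤ C * ‖a‖ := by
  obtain ⟨δ, hδ, h⟩ := Metric.continuous_iff.1 (hφ b) 0 1 one_pos
  refine ⟨2 / δ, fun a ha ↦ ?_⟩
  rcases eq_or_ne a 0 with rfl | ha0
  · simp
  have hn : 0 < ‖a‖ := norm_pos_iff.2 ha0
  set c : ℝ := δ / (2 * ‖a‖) with hc
  have hc0 : 0 < c := by positivity
  have hsa : IsSelfAdjoint ((c : ℂ) • a) := by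
    rw [isSelfAdjoint_iff, star_smul, ha.star_eq]; simp
  have h1 := h ⟨(c : ℂ) • a, hsa⟩ (by
    rw [dist_zero_right]
    change ‖(c : ℂ) • a‖ < δ
    rw [norm_smul, Complex.norm_real, Real.norm_of_nonneg hc0.le, hc]
    field_simp
    linarith)
  simp only [ZeroMemClass.coe_zero, mul_zero, zero_mul, map_zero, dist_zero_right,
    mul_smul_comm, smul_mul_assoc, map_smul, smul_eq_mul, norm_mul, Complex.norm_real,
    Real.norm_of_nonneg hc0.le] at h1
  rw [hc] at h1
  calc ‖φ (star b * a * b)‖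
      = (2 * ‖a‖ / δ) * (δ / (2 * ‖a‖) * ‖φ (star b * a * b)‖) := by field_simp
    _ ≤ (2 * ‖a‖ / δ) * 1 := by gcongr
    _ = 2 / δ * ‖a‖ := by ring

/-- Polarization: the vanishing imaginary parts at `a + b` and at `a + I • b` give the imaginary and
the real part of the identity. -/
lemma IsPositive.conj_symm {φ : A →ₗ[ℂ] ℂ} (hφ : IsPositive φ) (a b : A) :
    star (φ (star b * a)) = φ (star a * b) := by
  have im0 (c : A) : (φ (star c * c)).im = 0 := (Complex.nonneg_iff.1 (hφ c)).2.symm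
  have h1 := im0 (a + b)
  have h2 := im0 (a + I • b)
  have ha := im0 a
  have hb := im0 b
  simp only [star_add, add_mul, mul_add, map_add, star_smul, smul_mul_assoc, mul_smul_comm,
    map_smul, smul_eq_mul, Complex.add_im, Complex.mul_im, Complex.star_def, Complex.conj_I,
    Complex.neg_re, Complex.neg_im, Complex.I_re, Complex.I_im, Complex.mul_re, ha, hb] at h1 h2
  apply Complex.ext
  · simp only [Complex.star_def, Complex.conj_re]; linarith
  · simp only [Complex.star_def, Complex.conj_im]; linarith

/-- The type synonym of `A` carrying the semi-inner product `⟪a, b⟫ = φ (a* b)`. -/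
@[nolint unusedArguments]
def PreGNS {φ : A →ₗ[ℂ] ℂ} (_ : IsPositive φ) : Type _ := A

namespace PreGNS

variable {φ : A →ₗ[ℂ] ℂ} (hφ : IsPositive φ)

noncomputable instance : AddCommGroup (PreGNS hφ) := inferInstanceAs (AddCommGroup A)
noncomputable instance : Module ℂ (PreGNS hφ) := inferInstanceAs (Module ℂ A)

/-- The identity of `A`, as a map to `PreGNS`. -/
def mk : A ≃ₗ[ℂ] PreGNS hφ := LinearEquiv.refl ℂ _

/-- The semi-inner product `⟪a, b⟫ = φ (a* b)`. -/
noncomputable abbrev core : PreInnerProductSpace.Core ℂ (PreGNS hφ) where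
  inner a b := φ (star ((mk hφ).symm a) * (mk hφ).symm b)
  conj_inner_symm a b := hφ.conj_symm _ _
  re_inner_nonneg a := (Complex.nonneg_iff.1 (hφ _)).1
  add_left _ _ _ := by rw [map_add, star_add, add_mul, map_add]
  smul_left _ _ _ := by rw [map_smul, star_smul, smul_mul_assoc, map_smul]; rfl

noncomputable instance : SeminormedAddCommGroup (PreGNS hφ) :=
  InnerProductSpace.Core.toSeminormedAddCommGroup (c := core hφ)
noncomputable instance : InnerProductSpace ℂ (PreGNS hφ) :=
  InnerProductSpace.ofCore (core hφ)

lemma inner_mk (a b : A) : ⟪mk hφ a, mk hφ b⟫_ℂ = φ (star a * b) := rfl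

lemma norm_mk_sq (a : A) : ‖mk hφ a‖ ^ 2 = (φ (star a * a)).re := by
  rw [@norm_sq_eq_re_inner ℂ, inner_mk]; rfl

lemma norm_mk_mul_sq {a : A} (ha : IsSelfAdjoint a) (b : A) :
    ((‖mk hφ (a * b)‖ ^ 2 : ℝ) : ℂ) = ⟪mk hφ b, mk hφ (a * a * b)⟫_ℂ := by
  rw [Complex.ofReal_pow]
  erw [← inner_self_eq_norm_sq_to_K (𝕜 := ℂ) (mk hφ (a * b))]
  rw [inner_mk, inner_mk, star_mul, ha.star_eq]
  congr 1
  simp only [mul_assoc]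

/-- Cauchy–Schwarz gives `‖ab‖² ≤ ‖b‖ ‖a²b‖`. Iterating bounds `(‖ab‖ / ‖b‖) ^ 2 ^ n` by `‖a ^ 2 ^ n
b‖ / ‖b‖`, and weak continuity controls the latter up to a constant independent of `n`, which
disappears on taking roots. -/
lemma norm_mk_mul_le_of_isSelfAdjoint (hc : IsWeaklyContinuousOnSA φ) {a : A}
    (ha : IsSelfAdjoint a) (b : A) : ‖mk hφ (a * b)‖ ≤ ‖a‖ * ‖mk hφ b‖ := by
  have key (n : ℕ) : ‖mk hφ (sqIter a n * b)‖ ^ 2 ≤ ‖mk hφ b‖ * ‖mk hφ (sqIter a (n + 1) * b)‖ := by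
    have := norm_inner_le_norm (𝕜 := ℂ) (mk hφ b) (mk hφ (sqIter a n * sqIter a n * b))
    rw [← norm_mk_mul_sq hφ (isSelfAdjoint_sqIter ha n), Complex.norm_real,
      Real.norm_of_nonneg (by positivity)] at this
    exact this
  -- This is only a seminorm, so `b` may be null; then `key 0` already forces `ab` to be null.
  rcases (norm_nonneg (mk hφ b)).eq_or_lt with hb | hb
  · have := key 0
    rw [← hb, zero_mul] at this
    rw [← hb, mul_zero]
    exact (pow_eq_zero_iff two_ne_zero).1 (this.antisymm (by positivity)) |>.le
  obtain ⟨C, hC⟩ := hc.exists_bound b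
  have key2 (n : ℕ) : (‖mk hφ (a * b)‖ / ‖mk hφ b‖) ^ 2 ^ n
      ≤ ‖mk hφ (sqIter a n * b)‖ / ‖mk hφ b‖ := by
    induction n with
    | zero => simp [sqIter]
    | succ n ih =>
      calc (‖mk hφ (a * b)‖ / ‖mk hφ b‖) ^ 2 ^ (n + 1)
          = ((‖mk hφ (a * b)‖ / ‖mk hφ b‖) ^ 2 ^ n) ^ 2 := by rw [← pow_mul, pow_succ 2 n]
        _ ≤ (‖mk hφ (sqIter a n * b)‖ / ‖mk hφ b‖) ^ 2 := by gcongr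
        _ ≤ (‖mk hφ b‖ * ‖mk hφ (sqIter a (n + 1) * b)‖) / ‖mk hφ b‖ ^ 2 := by
          rw [div_pow]; gcongr; exact key n
        _ = _ := by field_simp
  have key3 (n : ℕ) : ‖mk hφ (sqIter a n * b)‖ ^ 2 ≤ |C| * (‖a‖ ^ 2) ^ 2 ^ n := by
    have h1 : ‖mk hφ (sqIter a n * b)‖ ^ 2 = ‖φ (star b * sqIter a (n + 1) * b)‖ := by
      have := norm_mk_mul_sq hφ (isSelfAdjoint_sqIter ha n) b
      rw [inner_mk, ← mul_assoc] at this
      change _ = φ (star b * sqIter a (n + 1) * b) at this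
      rw [← this, Complex.norm_real, Real.norm_of_nonneg (by positivity)]
    rw [h1]
    calc _ ≤ C * ‖sqIter a (n + 1)‖ := hC _ (isSelfAdjoint_sqIter ha _)
      _ ≤ |C| * ‖sqIter a (n + 1)‖ := by gcongr; exact le_abs_self C
      _ ≤ |C| * ‖a‖ ^ 2 ^ (n + 1) := by gcongr; exact norm_sqIter_le a _
      _ = _ := by rw [← pow_mul, pow_succ' 2 n]
  have key4 : (‖mk hφ (a * b)‖ / ‖mk hφ b‖) ^ 2 ≤ ‖a‖ ^ 2 := by
    refine le_of_forall_pow_two_pow_le (C := |C| / ‖mk hφ b‖ ^ 2) (by positivity) fun n ↦ ?_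
    calc ((‖mk hφ (a * b)‖ / ‖mk hφ b‖) ^ 2) ^ 2 ^ n
        = ((‖mk hφ (a * b)‖ / ‖mk hφ b‖) ^ 2 ^ n) ^ 2 := by rw [← pow_mul, ← pow_mul, mul_comm (2 ^ n)]
      _ ≤ (‖mk hφ (sqIter a n * b)‖ / ‖mk hφ b‖) ^ 2 := by gcongr; exact key2 n
      _ ≤ (|C| * (‖a‖ ^ 2) ^ 2 ^ n) / ‖mk hφ b‖ ^ 2 := by rw [div_pow]; gcongr; exact key3 n
      _ = _ := by ring
  rw [← div_le_iff₀ hb]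
  exact (sq_le_sq₀ (by positivity) (by positivity)).1 key4

/-- Since `‖ab‖² = ⟪b, a*ab⟫`, the self-adjoint case applies to `a*a`. The involution need not be
continuous, so `‖star a * a‖` is kept rather than compared with `‖a‖²`. -/
lemma norm_mk_mul_le (hc : IsWeaklyContinuousOnSA φ) (a b : A) :
    ‖mk hφ (a * b)‖ ≤ √‖star a * a‖ * ‖mk hφ b‖ := by
  refine (sq_le_sq₀ (by positivity) (by positivity)).1 ?_
  rw [mul_pow, Real.sq_sqrt (norm_nonneg _)]
  have h1 : ‖mk hφ (a * b)‖ ^ 2 = (⟪mk hφ b, mk hφ (star a * a * b)⟫_ℂ).re := by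
    rw [norm_mk_sq, inner_mk, star_mul]
    simp only [mul_assoc]
  calc ‖mk hφ (a * b)‖ ^ 2 ≤ ‖⟪mk hφ b, mk hφ (star a * a * b)⟫_ℂ‖ := h1 ▸ Complex.re_le_norm _
    _ ≤ ‖mk hφ b‖ * ‖mk hφ (star a * a * b)‖ := norm_inner_le_norm _ _
    _ ≤ ‖mk hφ b‖ * (‖star a * a‖ * ‖mk hφ b‖) := by
      gcongr; exact norm_mk_mul_le_of_isSelfAdjoint hφ hc (.star_mul_self a) b
    _ = _ := by ring

/-- Left multiplication by `a` as a bounded operator. -/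
noncomputable def leftMul (hc : IsWeaklyContinuousOnSA φ) (a : A) : PreGNS hφ →L[ℂ] PreGNS hφ :=
  ((mk hφ).toLinearMap ∘ₗ LinearMap.mulLeft ℂ a ∘ₗ (mk hφ).symm.toLinearMap).mkContinuous
    √‖star a * a‖ fun b ↦ norm_mk_mul_le hφ hc a ((mk hφ).symm b)

variable {hφ} in
lemma completion_ext {F : Type*} [TopologicalSpace F] [T2Space F] {f g : Completion (PreGNS hφ) → F}
    (hf : Continuous f) (hg : Continuous g)
    (h : ∀ a, f (mk hφ a : PreGNS hφ) = g (mk hφ a : PreGNS hφ)) : f = g := by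
  funext c
  induction c using induction_on with
  | hp => exact isClosed_eq hf hg
  | ih c => exact h ((mk hφ).symm c)

/-- The operator of left multiplication by `a` on the completion of `PreGNS`. -/
noncomputable def repOp (hc : IsWeaklyContinuousOnSA φ) (a : A) :
    Completion (PreGNS hφ) →L[ℂ] Completion (PreGNS hφ) :=
  (leftMul hφ hc a).completion

lemma repOp_mk (hc : IsWeaklyContinuousOnSA φ) (a b : A) :
    repOp hφ hc a (mk hφ b : PreGNS hφ) = (mk hφ (a * b) : PreGNS hφ) :=
  ContinuousLinearMap.completion_apply_coe _ _

lemma repOp_smul (hc : IsWeaklyContinuousOnSA φ) (m : ℂ) (a : A) :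
    repOp hφ hc (m • a) = m • repOp hφ hc a := by
  ext x
  refine congrFun (completion_ext (f := fun x ↦ repOp hφ hc (m • a) x)
    (g := fun x ↦ m • repOp hφ hc a x) (by fun_prop)
    ((repOp hφ hc a).continuous.const_smul m) fun b ↦ ?_) x
  simp only [repOp_mk]
  rw [smul_mul_assoc, map_smul, Completion.coe_smul]

lemma repOp_add (hc : IsWeaklyContinuousOnSA φ) (a b : A) :
    repOp hφ hc (a + b) = repOp hφ hc a + repOp hφ hc b := by
  refine DFunLike.coe_injective (completion_ext (by fun_prop) (by fun_prop) fun c ↦ ?_)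
  rw [add_apply, repOp_mk, repOp_mk, repOp_mk, add_mul, map_add,
    Completion.coe_add]

lemma repOp_mul (hc : IsWeaklyContinuousOnSA φ) (a b : A) :
    repOp hφ hc (a * b) = repOp hφ hc a * repOp hφ hc b := by
  refine DFunLike.coe_injective (completion_ext (by fun_prop) (by fun_prop) fun c ↦ ?_)
  rw [mul_apply_eq_comp, repOp_mk, repOp_mk, repOp_mk, mul_assoc]

lemma inner_repOp (hc : IsWeaklyContinuousOnSA φ) (a : A) (x y : Completion (PreGNS hφ)) :
    ⟪repOp hφ hc (star a) x, y⟫_ℂ = ⟪x, repOp hφ hc a y⟫_ℂ := by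
  refine congrFun (completion_ext (f := fun x ↦ ⟪repOp hφ hc (star a) x, y⟫_ℂ)
    (g := fun x ↦ ⟪x, repOp hφ hc a y⟫_ℂ) (by fun_prop) (by fun_prop) fun b ↦ ?_) x
  refine congrFun (completion_ext (f := fun y ↦ ⟪repOp hφ hc (star a) _, y⟫_ℂ)
    (g := fun y ↦ ⟪_, repOp hφ hc a y⟫_ℂ) (by fun_prop) (by fun_prop) fun c ↦ ?_) y
  simp only [repOp_mk, inner_coe, inner_mk, star_mul, star_star, mul_assoc]

lemma repOp_star (hc : IsWeaklyContinuousOnSA φ) (a : A) :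
    repOp hφ hc (star a) = star (repOp hφ hc a) :=
  (ContinuousLinearMap.eq_adjoint_iff _ _).mpr (inner_repOp hφ hc a)

/-- The GNS representation on the completion of `PreGNS`. -/
noncomputable def rep (hc : IsWeaklyContinuousOnSA φ) :
    A →⋆ₙₐ[ℂ] (Completion (PreGNS hφ) →L[ℂ] Completion (PreGNS hφ)) where
  toFun := repOp hφ hc
  map_smul' := repOp_smul hφ hc
  map_zero' := by simpa using repOp_smul hφ hc 0 0
  map_add' := repOp_add hφ hc
  map_mul' := repOp_mul hφ hc
  map_star' := repOp_star hφ hc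

lemma rep_mk (hc : IsWeaklyContinuousOnSA φ) (a b : A) :
    rep hφ hc a (mk hφ b : PreGNS hφ) = (mk hφ (a * b) : PreGNS hφ) :=
  repOp_mk hφ hc a b

lemma norm_rep_le (hc : IsWeaklyContinuousOnSA φ) (a : A) :
    ‖rep hφ hc a‖ ≤ √‖star a * a‖ := by
  refine ContinuousLinearMap.opNorm_le_bound _ (by positivity) fun x ↦ ?_
  induction x using induction_on with
  | hp => apply isClosed_le <;> fun_prop
  | ih x =>
    obtain ⟨x, rfl⟩ := (mk hφ).surjective x
    rw [rep_mk, norm_coe, norm_coe]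
    exact norm_mk_mul_le hφ hc a x

end PreGNS

/-- The GNS representation of a state, with its cyclic unit vector. -/
theorem exists_gns {φ : A →ₗ[ℂ] ℂ} (hφ : φ ∈ States A) :
    ∃ (H : Type u) (_ : NormedAddCommGroup H) (_ : InnerProductSpace ℂ H) (_ : CompleteSpace H)
      (π : A →⋆ₙₐ[ℂ] (H →L[ℂ] H)) (ξ : H), ‖ξ‖ = 1 ∧ (∀ a, φ a = ⟪ξ, π a ξ⟫_ℂ) ∧
      DenseRange (fun a ↦ π a ξ) ∧ ∀ a, ‖π a‖ ≤ √‖star a * a‖ := by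
  obtain ⟨hp, hc, hne, hv⟩ := hφ
  have hbdd : BddBelow (variationBounds φ) := ⟨0, fun v hv ↦ hv.1⟩
  -- The infimum defining the variation is attained: the inequality passes to the limit along a
  -- minimizing sequence, so `1` itself is a bound.
  have hle (a : A) : ‖φ a‖ ≤ ‖PreGNS.mk hp a‖ := by
    refine (sq_le_sq₀ (by positivity) (by positivity)).1 ?_
    rw [PreGNS.norm_mk_sq]
    obtain ⟨u, -, hu, hus⟩ := exists_seq_tendsto_sInf hne hbdd
    have : Tendsto (fun n ↦ u n * (φ (star a * a)).re) atTop (𝓝 (1 * (φ (star a * a)).re)) := by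
      refine Tendsto.mul_const _ ?_
      rw [← hv]; exact hu
    rw [one_mul] at this
    exact ge_of_tendsto' this fun n ↦ (hus n).2 a
  let f₀ : PreGNS hp →L[ℂ] ℂ := (φ ∘ₗ (PreGNS.mk hp).symm.toLinearMap).mkContinuous 1
    fun a ↦ by rw [one_mul]; exact hle _
  let f : Completion (PreGNS hp) →L[ℂ] ℂ := f₀.fromCompletion
  have hf (a : A) : f (PreGNS.mk hp a : PreGNS hp) = φ a := f₀.fromCompletion_apply_coe _
  let ξ := (InnerProductSpace.toDual ℂ (Completion (PreGNS hp))).symm f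
  have hξ (x) : ⟪ξ, x⟫_ℂ = f x := InnerProductSpace.toDual_symm_apply
  -- The vector `ξ` plays the role of the missing unit: against the class of `x`, both sides give `φ
  -- (a* x)`. This yields cyclicity as well as the formula for `φ`.
  have hπ (a : A) : PreGNS.rep hp hc a ξ = (PreGNS.mk hp a : PreGNS hp) := by
    refine ext_inner_right ℂ fun x ↦ ?_
    induction x using induction_on with
    | hp => apply isClosed_eq <;> fun_prop
    | ih x =>
      obtain ⟨x, rfl⟩ := (PreGNS.mk hp).surjective x
      rw [← ContinuousLinearMap.adjoint_inner_right, ← ContinuousLinearMap.star_eq_adjoint,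
        ← map_star, PreGNS.rep_mk, hξ, hf, inner_coe, PreGNS.inner_mk]
  refine ⟨Completion (PreGNS hp), inferInstance, inferInstance, inferInstance,
    PreGNS.rep hp hc, ξ, ?_, fun a ↦ ?_, ?_, PreGNS.norm_rep_le hp hc⟩
  · apply le_antisymm
    · rw [LinearIsometryEquiv.norm_map]
      refine ContinuousLinearMap.opNorm_le_bound _ zero_le_one fun x ↦ ?_
      induction x using induction_on with
      | hp => apply isClosed_le <;> fun_prop
      | ih x =>
        obtain ⟨x, rfl⟩ := (PreGNS.mk hp).surjective x
        rw [hf, one_mul, norm_coe]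
        exact hle x
    -- By Cauchy–Schwarz `‖ξ‖²` is a variation bound, hence at least the infimum `1`.
    · have : ‖ξ‖ ^ 2 ∈ variationBounds φ := by
        refine ⟨by positivity, fun a ↦ ?_⟩
        rw [← hf, ← hξ, ← PreGNS.norm_mk_sq hp, ← mul_pow, ← norm_coe (PreGNS.mk hp a)]
        gcongr
        exact norm_inner_le_norm _ _
      have := csInf_le hbdd this
      change variation φ ≤ _ at this
      rw [hv] at this
      exact (one_le_sq_iff₀ (norm_nonneg _)).1 this
  · rw [hπ, hξ, hf]
  · simp_rw [hπ]
    exact Completion.denseRange_coe.comp (PreGNS.mk hp).surjective.denseRange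
      (Completion.continuous_coe _)

end AbstractBochner

/-! ### Riesz representation and the spectral measure of a state. -/

namespace AbstractBochner

open scoped InnerProductSpace CompactlySupported
open Complex Filter Topology

/-- The complex form of the Riesz–Markov–Kakutani theorem on a compact Hausdorff space. -/
theorem exists_regular_integral_eq {X : Type*} [TopologicalSpace X] [CompactSpace X] [T2Space X]
    [MeasurableSpace X] [BorelSpace X] (L : C(X, ℂ) →ₗ[ℂ] ℂ) (hL : ∀ f, 0 ≤ L (star f * f)) :
    ∃ ν : Measure X, ν.Regular ∧ IsFiniteMeasure ν ∧ ∀ f, L f = ∫ x, f x ∂ν := by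
  let toC (g : X → ℝ) (hg : Continuous g) : C(X, ℂ) := ⟨fun x ↦ (g x : ℂ), by fun_prop⟩
  have hpos (g : X → ℝ) (hg : Continuous g) (h0 : ∀ x, 0 ≤ g x) : 0 ≤ L (toC g hg) := by
    have : toC g hg = star (toC (fun x ↦ √(g x)) (by fun_prop)) *
        toC (fun x ↦ √(g x)) (by fun_prop) := by
      ext x
      simp [toC, ← Complex.ofReal_mul, Real.mul_self_sqrt (h0 x)]
    rw [this]
    exact hL _
  have hreal (g : X → ℝ) (hg : Continuous g) : (L (toC g hg)).im = 0 := by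
    -- A difference of two nonnegative continuous functions, on each of which `L` is real.
    have h1 : toC g hg = toC (fun x ↦ |g x| + g x) (by fun_prop) -
        toC (fun x ↦ |g x|) (by fun_prop) := by
      ext x; simp [toC]
    have h2 := hpos (fun x ↦ |g x| + g x) (by fun_prop) fun x ↦ by linarith [neg_abs_le (g x)]
    have h3 := hpos (fun x ↦ |g x|) (by fun_prop) fun x ↦ abs_nonneg _
    rw [h1, map_sub, Complex.sub_im, ← (Complex.nonneg_iff.1 h2).2,
      ← (Complex.nonneg_iff.1 h3).2, sub_zero]
  let Λ : C_c(X, ℝ) →ₚ[ℝ] ℝ := PositiveLinearMap.mk₀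
    { toFun := fun g ↦ (L (toC g g.continuous)).re
      map_add' := fun f g ↦ by
        rw [← Complex.add_re, ← map_add]; congr 2; ext x; simp [toC]
      map_smul' := fun c g ↦ by
        rw [RingHom.id_apply, smul_eq_mul, ← Complex.re_ofReal_mul, ← smul_eq_mul (c : ℂ),
          ← map_smul]
        congr 2; ext x; simp [toC] }
    fun g hg ↦ (Complex.nonneg_iff.1 (hpos g g.continuous hg)).1
  have hΛ (g : X → ℝ) (hg : Continuous g) :
      L (toC g hg) = ((∫ x, g x ∂(RealRMK.rieszMeasure Λ) : ℝ) : ℂ) := by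
    have := RealRMK.integral_rieszMeasure Λ ⟨⟨g, hg⟩, HasCompactSupport.of_compactSpace _⟩
    apply Complex.ext
    · rw [Complex.ofReal_re]; exact this.symm
    · rw [hreal g hg, Complex.ofReal_im]
  refine ⟨RealRMK.rieszMeasure Λ, inferInstance, inferInstance, fun f ↦ ?_⟩
  have hf : f = toC (fun x ↦ (f x).re) (by fun_prop) + I • toC (fun x ↦ (f x).im) (by fun_prop) := by
    ext x
    simp only [toC, ContinuousMap.add_apply, ContinuousMap.coe_mk, ContinuousMap.smul_apply,
      smul_eq_mul]
    rw [mul_comm, Complex.re_add_im]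
  have hint : Integrable f (RealRMK.rieszMeasure Λ) :=
    f.continuous.integrable_of_hasCompactSupport (HasCompactSupport.of_compactSpace _)
  conv_lhs => rw [hf]
  rw [map_add, map_smul, hΛ _ (by fun_prop), hΛ _ (by fun_prop), smul_eq_mul, mul_comm]
  exact integral_re_add_im hint

universe u

section Spectral

variable {A : Type u} [NonUnitalNormedCommRing A] [StarRing A] [NormedSpace ℂ A]

variable {H : Type u} [NormedAddCommGroup H] [InnerProductSpace ℂ H] [CompleteSpace H]

/-- The commutative unital C⋆-algebra of operators generated by a representation. -/
noncomputable abbrev repClosure (π : A →⋆ₙₐ[ℂ] (H →L[ℂ] H)) : StarSubalgebra ℂ (H →L[ℂ] H) :=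
  (StarAlgebra.adjoin ℂ (Set.range π)).topologicalClosure

lemma repClosure_mul_comm (π : A →⋆ₙₐ[ℂ] (H →L[ℂ] H)) (x y : repClosure π) : x * y = y * x := by
  have := StarAlgebra.isMulCommutative_adjoin ℂ (s := Set.range π)
    (by rintro _ ⟨a, rfl⟩ _ ⟨b, rfl⟩; rw [← map_mul, ← map_mul, mul_comm])
    (by rintro _ ⟨a, rfl⟩ _ ⟨b, rfl⟩; rw [← map_star, ← map_mul, ← map_mul, mul_comm])
  let := StarSubalgebra.commRingTopologicalClosure (StarAlgebra.adjoin ℂ (Set.range π))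
    fun x y ↦ this.is_comm.comm x y
  exact mul_comm x y

noncomputable instance (π : A →⋆ₙₐ[ℂ] (H →L[ℂ] H)) : NormedCommRing (repClosure π) :=
  { SubringClass.toNormedRing (repClosure π) with
    mul_comm := repClosure_mul_comm π }

noncomputable instance (π : A →⋆ₙₐ[ℂ] (H →L[ℂ] H)) : CommCStarAlgebra (repClosure π) where
  complete := ((StarSubalgebra.isClosed_topologicalClosure _).completeSpace_coe).complete

/-- A representation, with values in the C⋆-algebra it generates. -/
noncomputable def repRestrict (π : A →⋆ₙₐ[ℂ] (H →L[ℂ] H)) : A →⋆ₙₐ[ℂ] repClosure π where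
  toFun a := ⟨π a, StarSubalgebra.le_topologicalClosure _
    (StarAlgebra.subset_adjoin ℂ _ ⟨a, rfl⟩)⟩
  map_smul' m a := Subtype.ext (map_smul π m a)
  map_zero' := Subtype.ext (map_zero π)
  map_add' a b := Subtype.ext (map_add π a b)
  map_mul' a b := Subtype.ext (map_mul π a b)
  map_star' a := Subtype.ext (map_star π a)

lemma norm_repRestrict (π : A →⋆ₙₐ[ℂ] (H →L[ℂ] H)) (a : A) : ‖repRestrict π a‖ = ‖π a‖ := rfl

lemma inner_star_mul_self_apply (T : H →L[ℂ] H) (ξ : H) :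
    ⟪ξ, (star T * T) ξ⟫_ℂ = ⟪T ξ, T ξ⟫_ℂ := by
  rw [mul_apply_eq_comp, ContinuousLinearMap.star_eq_adjoint,
    ContinuousLinearMap.adjoint_inner_right]

/-- The vector functional of `ξ` on the C⋆-algebra generated by a representation. -/
noncomputable def vectorFunctional (π : A →⋆ₙₐ[ℂ] (H →L[ℂ] H)) (ξ : H) : repClosure π →ₗ[ℂ] ℂ where
  toFun T := ⟪ξ, (T : H →L[ℂ] H) ξ⟫_ℂ
  map_add' _ _ := inner_add_right _ _ _
  map_smul' _ _ := inner_smul_right _ _ _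

lemma vectorFunctional_star_mul_self_nonneg (π : A →⋆ₙₐ[ℂ] (H →L[ℂ] H)) (ξ : H)
    (T : repClosure π) : 0 ≤ vectorFunctional π ξ (star T * T) := by
  have h : ((star T * T : repClosure π) : H →L[ℂ] H) = star (T : H →L[ℂ] H) * T := rfl
  have : vectorFunctional π ξ (star T * T) = ⟪ξ, ((star T * T : repClosure π) : H →L[ℂ] H) ξ⟫_ℂ :=
    rfl
  rw [this, h, inner_star_mul_self_apply, inner_self_eq_norm_sq_to_K]
  have := Complex.zero_le_real.2 (sq_nonneg ‖(T : H →L[ℂ] H) ξ‖)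
  rwa [Complex.ofReal_pow] at this

/-- A positive functional on a commutative unital C⋆-algebra is an integral over the character
space. -/
theorem exists_measure_characterSpace {B : Type*} [CommCStarAlgebra B] (L : B →ₗ[ℂ] ℂ)
    (hL : ∀ b, 0 ≤ L (star b * b)) :
    letI := borel (WeakDual.characterSpace ℂ B)
    ∃ ν : Measure (WeakDual.characterSpace ℂ B), ν.Regular ∧ IsFiniteMeasure ν ∧
      ∀ b, L b = ∫ x, gelfandStarTransform B b x ∂ν := by
  let : MeasurableSpace (WeakDual.characterSpace ℂ B) := borel _
  have : BorelSpace (WeakDual.characterSpace ℂ B) := ⟨rfl⟩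
  let G := gelfandStarTransform B
  let M : C(WeakDual.characterSpace ℂ B, ℂ) →ₗ[ℂ] ℂ :=
    { toFun := fun f ↦ L (G.symm f)
      map_add' := fun f g ↦ by rw [map_add, map_add]
      map_smul' := fun c f ↦ by rw [map_smul, map_smul]; rfl }
  obtain ⟨ν, hreg, hfin, hν⟩ := exists_regular_integral_eq M fun f ↦ by
    change 0 ≤ L (G.symm (star f * f))
    rw [map_mul, map_star]
    exact hL _
  refine ⟨ν, hreg, hfin, fun b ↦ ?_⟩
  rw [← hν]
  change L b = L (G.symm (G b))
  rw [StarAlgEquiv.symm_apply_apply]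

/-- Simultaneous diagonalization: the vector functional of a representation of a commutative
`*`-algebra is an integral over a compact space. -/
theorem exists_spectral_measure (π : A →⋆ₙₐ[ℂ] (H →L[ℂ] H)) (ξ : H) (hξ : ‖ξ‖ = 1) :
    ∃ (X : Type u) (_ : TopologicalSpace X) (_ : CompactSpace X) (_ : T2Space X)
      (_ : MeasurableSpace X) (_ : BorelSpace X) (ν : Measure X) (e : A →⋆ₙₐ[ℂ] C(X, ℂ)),
      ν.Regular ∧ IsProbabilityMeasure ν ∧ (∀ a, ‖e a‖ ≤ ‖π a‖) ∧
      ∀ a, ⟪ξ, π a ξ⟫_ℂ = ∫ x, e a x ∂ν := by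
  let : MeasurableSpace (WeakDual.characterSpace ℂ (repClosure π)) := borel _
  obtain ⟨ν, hreg, hfin, hν⟩ := exists_measure_characterSpace (vectorFunctional π ξ)
    (vectorFunctional_star_mul_self_nonneg π ξ)
  let G := gelfandStarTransform (repClosure π)
  let e : A →⋆ₙₐ[ℂ] C(WeakDual.characterSpace ℂ (repClosure π), ℂ) :=
    (G : repClosure π →⋆ₙₐ[ℂ] C(WeakDual.characterSpace ℂ (repClosure π), ℂ)).comp (repRestrict π)
  refine ⟨_, inferInstance, inferInstance, inferInstance, inferInstance, ⟨rfl⟩, ν, e,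
    hreg, ⟨?_⟩, fun a ↦ ?_, fun a ↦ ?_⟩
  -- The total mass is the functional at the identity operator, that is `‖ξ‖² = 1`.
  · have h1 := hν 1
    have h2 : vectorFunctional π ξ 1 = 1 := by
      change ⟪ξ, ξ⟫_ℂ = 1
      rw [inner_self_eq_norm_sq_to_K, hξ]; simp
    rw [h2, map_one] at h1
    simp only [ContinuousMap.one_apply, integral_const, Complex.real_smul, mul_one] at h1
    rw [← ofReal_measureReal, (by exact_mod_cast h1.symm : ν.real Set.univ = 1),
      ENNReal.ofReal_one]
  · rw [← norm_repRestrict]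
    exact ((gelfandTransform_isometry (repClosure π)).norm_map_of_map_zero (map_zero _)
      (repRestrict π a)).le
  · exact hν (repRestrict π a)

end Spectral

section

variable {A : Type u} [NonUnitalNormedCommRing A] [StarRing A] [NormedSpace ℂ A]
  [IsScalarTower ℂ A A] [SMulCommClass ℂ A A] [StarModule ℂ A]

/-- A state is an integral over a compact space on which `A` is represented by continuous
functions, and these approximate `1` in mean square. -/
theorem exists_spectral_measure_of_mem_states {φ : A →ₗ[ℂ] ℂ} (hφ : φ ∈ States A) :
    ∃ (X : Type u) (_ : TopologicalSpace X) (_ : CompactSpace X) (_ : T2Space X)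
      (_ : MeasurableSpace X) (_ : BorelSpace X) (ν : Measure X) (e : A →⋆ₙₐ[ℂ] C(X, ℂ)),
      ν.Regular ∧ IsProbabilityMeasure ν ∧ (∀ a, ‖e a‖ ≤ √‖star a * a‖) ∧
      (∀ a, φ a = ∫ x, e a x ∂ν) ∧ ∀ ε > 0, ∃ a, ∫ x, ‖1 - e a x‖ ^ 2 ∂ν < ε := by
  obtain ⟨H, _, _, _, π, ξ, hξ, hπ, hd, hn⟩ := exists_gns hφ
  obtain ⟨X, _, _, _, _, _, ν, e, hreg, hprob, he, hν⟩ := exists_spectral_measure π ξ hξ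
  refine ⟨X, inferInstance, inferInstance, inferInstance, inferInstance, inferInstance, ν, e,
    hreg, hprob, fun a ↦ (he a).trans (hn a), fun a ↦ (hπ a).trans (hν a), fun ε hε ↦ ?_⟩
  obtain ⟨a, ha⟩ := hd.exists_dist_lt ξ (Real.sqrt_pos.2 hε)
  refine ⟨a, ?_⟩
  rw [dist_eq_norm, Real.lt_sqrt (norm_nonneg _)] at ha
  have hint (f : C(X, ℂ)) : Integrable f ν :=
    f.continuous.integrable_of_hasCompactSupport (HasCompactSupport.of_compactSpace _)
  have hsq (x : X) : ‖1 - e a x‖ ^ 2 = 1 - 2 * (e a x).re + (e (star a * a) x).re := by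
    rw [← Complex.normSq_eq_norm_sq, Complex.normSq_sub, map_mul, map_star]
    simp [Complex.normSq_apply]
    ring
  have hre (b : A) : ∫ x, (e b x).re ∂ν = (⟪ξ, π b ξ⟫_ℂ).re := by
    rw [hν]; exact integral_re (hint (e b))
  have hint_re (b : A) : Integrable (fun x ↦ (e b x).re) ν := (hint (e b)).re
  -- Same expansion as in `hsq`, so the mean square distance of `e a` from `1` equals `‖ξ - π a
  -- ξ‖²`, which is small by cyclicity.
  have h1 : ‖ξ - π a ξ‖ ^ 2 = 1 - 2 * (⟪ξ, π a ξ⟫_ℂ).re + (⟪ξ, π (star a * a) ξ⟫_ℂ).re := by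
    rw [@norm_sub_sq ℂ, hξ, map_mul, map_star, inner_star_mul_self_apply,
      one_pow, @norm_sq_eq_re_inner ℂ _ _ _ _ (π a ξ)]
    rfl
  rw [h1, ← hre, ← hre] at ha
  simp_rw [hsq]
  have h2 : Integrable (fun x ↦ 1 - 2 * (e a x).re) ν :=
    (integrable_const _).sub ((hint_re a).const_mul 2)
  rwa [integral_add h2 (hint_re _), integral_sub (integrable_const _) ((hint_re a).const_mul 2),
    integral_const_mul, integral_const, probReal_univ, one_smul]

end

end AbstractBochner

/-! ### Gelfand transforms, and the measure representing a state. -/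

namespace AbstractBochner

open Complex Filter Topology

section

variable {A : Type*} [NonUnitalNormedCommRing A] [StarRing A] [NormedSpace ℂ A]

instance : BorelSpace (BsaCharacter A) := ⟨rfl⟩

lemma continuous_gelfandHat_of_isSelfAdjoint {a : A} (ha : IsSelfAdjoint a) :
    Continuous (gelfandHat a) :=
  (continuous_apply (A := fun _ : selfAdjoint A ↦ ℂ) ⟨a, ha⟩).comp
    (continuous_induced_dom (f := fun (τ : BsaCharacter A) (a : selfAdjoint A) ↦
      gelfandHat (a : A) τ))

lemma gelfandHat_mul (a b : A) (τ : BsaCharacter A) :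
    gelfandHat (a * b) τ = gelfandHat a τ * gelfandHat b τ := τ.map_mul a b

lemma gelfandHat_star (a : A) (τ : BsaCharacter A) :
    gelfandHat (star a) τ = star (gelfandHat a τ) := τ.map_star a

lemma gelfandHat_add (a b : A) (τ : BsaCharacter A) :
    gelfandHat (a + b) τ = gelfandHat a τ + gelfandHat b τ := map_add τ.toLin a b

lemma gelfandHat_sub (a b : A) (τ : BsaCharacter A) :
    gelfandHat (a - b) τ = gelfandHat a τ - gelfandHat b τ := map_sub τ.toLin a b

lemma gelfandHat_smul (c : ℂ) (a : A) (τ : BsaCharacter A) :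
    gelfandHat (c • a) τ = c * gelfandHat a τ := map_smul τ.toLin c a

lemma gelfandHat_zero (τ : BsaCharacter A) : gelfandHat (0 : A) τ = 0 := map_zero τ.toLin

/-- Multiplicativity on iterated squares improves the unspecified constant `C` to `1`, uniformly in
`τ`. -/
lemma norm_gelfandHat_le_of_isSelfAdjoint {a : A} (ha : IsSelfAdjoint a) (τ : BsaCharacter A) :
    ‖gelfandHat a τ‖ ≤ ‖a‖ := by
  obtain ⟨C, hC⟩ := τ.bounded_sa
  have hp (k : ℕ) : gelfandHat (sqIter a k) τ = gelfandHat a τ ^ 2 ^ k := by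
    induction k with
    | zero => simp [sqIter]
    | succ k ih => rw [sqIter, gelfandHat_mul, ih, ← pow_add, pow_succ 2 k, mul_two]
  refine le_of_forall_pow_two_pow_le (C := |C|) (norm_nonneg a) fun k ↦ ?_
  rw [← norm_pow, ← hp]
  calc ‖gelfandHat (sqIter a k) τ‖ ≤ C * ‖sqIter a k‖ := hC ⟨_, isSelfAdjoint_sqIter ha k⟩
    _ ≤ |C| * ‖sqIter a k‖ := by gcongr; exact le_abs_self C
    _ ≤ |C| * ‖a‖ ^ 2 ^ k := by gcongr; exact norm_sqIter_le a k

lemma norm_gelfandHat_le (a : A) (τ : BsaCharacter A) : ‖gelfandHat a τ‖ ≤ √‖star a * a‖ := by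
  refine Real.le_sqrt_of_sq_le ?_
  have := norm_gelfandHat_le_of_isSelfAdjoint (IsSelfAdjoint.star_mul_self a) τ
  rwa [gelfandHat_mul, gelfandHat_star, norm_mul, norm_star, ← sq] at this

lemma gelfandHat_star_mul_self (a : A) (τ : BsaCharacter A) :
    gelfandHat (star a * a) τ = ((‖gelfandHat a τ‖ ^ 2 : ℝ) : ℂ) := by
  rw [gelfandHat_mul, gelfandHat_star, Complex.star_def, ← Complex.normSq_eq_conj_mul_self,
    Complex.normSq_eq_norm_sq]

lemma continuous_gelfandHat [StarModule ℂ A] (a : A) : Continuous (gelfandHat a) := by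
  have h : gelfandHat a = fun τ ↦ gelfandHat (realPart a : A) τ +
      I * gelfandHat (imaginaryPart a : A) τ := by
    funext τ
    rw [← gelfandHat_smul, ← gelfandHat_add, realPart_add_I_smul_imaginaryPart]
  rw [h]
  have h1 := continuous_gelfandHat_of_isSelfAdjoint (realPart a).2
  have h2 := continuous_gelfandHat_of_isSelfAdjoint (imaginaryPart a).2
  fun_prop

lemma integrable_gelfandHat [StarModule ℂ A] (μ : Measure (BsaCharacter A)) [IsFiniteMeasure μ]
    (a : A) : Integrable (gelfandHat a) μ :=
  .of_bound (continuous_gelfandHat a).aestronglyMeasurable _ (.of_forall (norm_gelfandHat_le a))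

end

section

universe u

variable {A : Type u} [NonUnitalNormedCommRing A] [StarRing A] [NormedSpace ℂ A]

/-- The character of `A` given by a point at which a representation by continuous functions does
not vanish. -/
noncomputable def BsaCharacter.ofPoint {X : Type*} [TopologicalSpace X] [CompactSpace X]
    (e : A →⋆ₙₐ[ℂ] C(X, ℂ)) (he : ∀ a, ‖e a‖ ≤ √‖star a * a‖) (x : X) (hx : ∃ a, e a x ≠ 0) :
    BsaCharacter A where
  toLin :=
    { toFun := fun a ↦ e a x
      map_add' := fun a b ↦ by rw [map_add]; rfl
      map_smul' := fun c a ↦ by rw [map_smul]; rfl }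
  ne_zero h := by
    obtain ⟨a, ha⟩ := hx
    exact ha (LinearMap.congr_fun h a)
  map_mul a b := by change e (a * b) x = _; rw [_root_.map_mul]; rfl
  map_star a := by
    change e (star a) x = _
    rw [StarHomClass.map_star]
    rfl
  bounded_sa := ⟨1, fun a ↦ by
    rw [one_mul]
    calc ‖e (a : A) x‖ ≤ ‖e (a : A)‖ := (e (a : A)).norm_coe_le_norm x
      _ ≤ √‖star (a : A) * a‖ := he a
      _ ≤ √(‖(a : A)‖ * ‖(a : A)‖) := by
        gcongr
        rw [selfAdjoint.star_val_eq]
        exact norm_mul_le _ _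
      _ = ‖(a : A)‖ := Real.sqrt_mul_self (norm_nonneg _)⟩

variable [IsScalarTower ℂ A A] [SMulCommClass ℂ A A] [StarModule ℂ A]

/-- Every state is represented by an inner regular probability measure on the characters. -/
theorem exists_measure_of_mem_states {φ : A →ₗ[ℂ] ℂ} (hφ : φ ∈ States A) :
    ∃ μ ∈ M₁ (BsaCharacter A), ∀ a, φ a = ∫ τ, gelfandHat a τ ∂μ := by
  obtain ⟨X, _, _, _, _, _, ν, e, hreg, hprob, he, hν, hone⟩ :=
    exists_spectral_measure_of_mem_states hφ
  have hint (f : X → ℝ) (hf : Continuous f) : Integrable f ν :=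
    hf.integrable_of_hasCompactSupport (HasCompactSupport.of_compactSpace _)
  -- Evaluation at a point outside `U` is the zero functional on `A`, which is not a character.
  let U : Set X := {x | ∃ a, e a x ≠ 0}
  have hU : IsOpen U := by
    have : U = ⋃ a, {x | e a x ≠ 0} := by ext; simp [U]
    rw [this]
    exact isOpen_iUnion fun a ↦ isOpen_ne_fun (e a).continuous continuous_const
  -- On `Uᶜ` the function `‖1 - e a‖ ^ 2` is identically `1`, so `ν Uᶜ` is at most its integral,
  -- which can be made arbitrarily small.
  have hUc : ν Uᶜ = 0 := by
    rw [← measureReal_eq_zero_iff]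
    refine le_antisymm (le_of_forall_pos_le_add fun ε hε ↦ ?_) measureReal_nonneg
    obtain ⟨a, ha⟩ := hone ε hε
    rw [zero_add]
    refine le_trans ?_ ha.le
    rw [← integral_indicator_one hU.measurableSet.compl]
    refine integral_mono ((integrable_const 1).indicator hU.measurableSet.compl)
      (hint _ (by fun_prop)) fun x ↦ ?_
    by_cases hx : x ∈ U
    · simp only [Set.indicator_of_notMem (Set.notMem_compl_iff.2 hx)]
      positivity
    · have h0 : e a x = 0 := by
        by_contra h
        exact hx ⟨a, h⟩
      simp [Set.indicator_of_mem (Set.mem_compl hx), h0]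
  have hemb : IsOpenEmbedding ((↑) : U → X) := hU.isOpenEmbedding_subtypeVal
  let q : U → BsaCharacter A := fun x ↦ BsaCharacter.ofPoint e he x x.2
  have hq : Continuous q := by
    refine continuous_induced_rng.2 (continuous_pi fun a ↦ ?_)
    exact (e (a : A)).continuous.comp continuous_subtype_val
  let ν' : Measure U := ν.comap (↑)
  have hν' : ν'.InnerRegular := Measure.InnerRegular.comap' ν hemb
  refine ⟨ν'.map q, ⟨⟨?_⟩, Measure.InnerRegular.map_of_continuous hq⟩, fun a ↦ ?_⟩
  · rw [Measure.map_apply hq.measurable MeasurableSet.univ, Set.preimage_univ,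
      hemb.measurableEmbedding.comap_apply, Set.image_univ, Subtype.range_coe,
      prob_compl_eq_zero_iff hU.measurableSet |>.1 hUc]
  · have hm : AEStronglyMeasurable (gelfandHat a) (ν'.map q) :=
      (continuous_gelfandHat a).aestronglyMeasurable
    rw [integral_map hq.aemeasurable hm, hν]
    change _ = ∫ x : U, e a x ∂(ν.comap (↑))
    rw [integral_subtype_comap hU.measurableSet, setIntegral_eq_integral_of_forall_compl_eq_zero]
    intro x hx
    by_contra h
    exact hx ⟨a, h⟩

end

end AbstractBochner

/-! ### Integration against a probability measure gives a state. -/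

namespace AbstractBochner

open scoped CompactlySupported
open Complex Filter Topology

section

variable {A : Type*} [NonUnitalNormedCommRing A] [StarRing A] [NormedSpace ℂ A] [StarModule ℂ A]

/-- The functional `a ↦ ∫ â dμ`. -/
noncomputable def integralFunctional (μ : Measure (BsaCharacter A)) [IsFiniteMeasure μ] :
    A →ₗ[ℂ] ℂ where
  toFun a := ∫ τ, gelfandHat a τ ∂μ
  map_add' a b := by
    simp_rw [gelfandHat_add]
    exact integral_add (integrable_gelfandHat μ a) (integrable_gelfandHat μ b)
  map_smul' c a := by
    simp_rw [gelfandHat_smul]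
    exact integral_const_mul c _

lemma integralFunctional_apply (μ : Measure (BsaCharacter A)) [IsFiniteMeasure μ] (a : A) :
    integralFunctional μ a = ∫ τ, gelfandHat a τ ∂μ := rfl

lemma integralFunctional_star_mul_self (μ : Measure (BsaCharacter A)) [IsFiniteMeasure μ] (a : A) :
    integralFunctional μ (star a * a) = ((∫ τ, ‖gelfandHat a τ‖ ^ 2 ∂μ : ℝ) : ℂ) := by
  simp_rw [integralFunctional_apply, gelfandHat_star_mul_self]
  exact integral_ofReal

lemma isPositive_integralFunctional (μ : Measure (BsaCharacter A)) [IsFiniteMeasure μ] :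
    IsPositive (integralFunctional μ) := fun a ↦ by
  rw [integralFunctional_star_mul_self]
  exact Complex.zero_le_real.2 (integral_nonneg fun τ ↦ by positivity)

lemma isWeaklyContinuousOnSA_integralFunctional (μ : Measure (BsaCharacter A))
    [IsFiniteMeasure μ] : IsWeaklyContinuousOnSA (integralFunctional μ) := fun b ↦ by
  have key (a : A) (ha : IsSelfAdjoint a) : ‖integralFunctional μ (star b * a * b)‖ ≤
      (‖star b * b‖ * μ.real Set.univ) * ‖a‖ := by
    calc ‖integralFunctional μ (star b * a * b)‖
        ≤ (‖star b * b‖ * ‖a‖) * μ.real Set.univ := by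
          refine norm_integral_le_of_norm_le_const (.of_forall fun τ ↦ ?_)
          rw [mul_right_comm, gelfandHat_mul, norm_mul]
          gcongr
          · exact norm_gelfandHat_le_of_isSelfAdjoint (IsSelfAdjoint.star_mul_self b) τ
          · exact norm_gelfandHat_le_of_isSelfAdjoint ha τ
      _ = _ := by ring
  refine (LipschitzWith.of_dist_le_mul (K := ⟨‖star b * b‖ * μ.real Set.univ, by positivity⟩)
    fun x y ↦ ?_).continuous
  rw [dist_eq_norm, ← map_sub, ← sub_mul, ← mul_sub]
  rw [Subtype.dist_eq, dist_eq_norm]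
  exact key _ (x - y).2

lemma one_mem_variationBounds (μ : Measure (BsaCharacter A)) [IsProbabilityMeasure μ] :
    1 ∈ variationBounds (integralFunctional μ) := by
  refine ⟨zero_le_one, fun a ↦ ?_⟩
  rw [integralFunctional_star_mul_self, Complex.ofReal_re, one_mul]
  have h1 : Integrable (fun τ ↦ ‖gelfandHat a τ‖) μ := (integrable_gelfandHat μ a).norm
  have h2 : Integrable (fun τ ↦ ‖gelfandHat a τ‖ ^ 2) μ := by
    have := (integrable_gelfandHat μ (star a * a)).norm
    simp_rw [gelfandHat_star_mul_self, Complex.norm_real, norm_pow, norm_norm] at this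
    exact this
  set m := ∫ τ, ‖gelfandHat a τ‖ ∂μ with hm
  -- Nonnegativity of the variance of `‖â‖`, whose mean is `m`.
  have h3 : 0 ≤ ∫ τ, (‖gelfandHat a τ‖ ^ 2 - 2 * m * ‖gelfandHat a τ‖ + m ^ 2) ∂μ :=
    integral_nonneg fun τ ↦ by
      have := sq_nonneg (‖gelfandHat a τ‖ - m)
      simp only [Pi.zero_apply]
      linarith
  have h4 : Integrable (fun τ ↦ ‖gelfandHat a τ‖ ^ 2 - 2 * m * ‖gelfandHat a τ‖) μ :=
    h2.sub (h1.const_mul _)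
  rw [integral_add h4 (integrable_const _), integral_sub h2 (h1.const_mul _),
    integral_const_mul, ← hm, integral_const, probReal_univ, one_smul] at h3
  calc ‖integralFunctional μ a‖ ^ 2 ≤ m ^ 2 := by gcongr; exact norm_integral_le_integral_norm _
    _ ≤ _ := by linarith

/-- On a compact set of characters some Gelfand transform is positive. -/
lemma exists_gelfandHat_pos_on_compact {K : Set (BsaCharacter A)}
    (hK : IsCompact K) : ∃ h : A, (∀ τ, 0 ≤ gelfandHat h τ) ∧ ∀ τ ∈ K, gelfandHat h τ ≠ 0 := by
  refine hK.induction_on (p := fun K ↦ ∃ h : A, (∀ τ, 0 ≤ gelfandHat h τ) ∧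
    ∀ τ ∈ K, gelfandHat h τ ≠ 0) ⟨0, fun τ ↦ (gelfandHat_zero τ).ge, fun τ hτ ↦ hτ.elim⟩ ?_ ?_ ?_
  · rintro s t hst ⟨h, h1, h2⟩
    exact ⟨h, h1, fun τ hτ ↦ h2 τ (hst hτ)⟩
  · rintro s t ⟨h, h1, h2⟩ ⟨h', h1', h2'⟩
    refine ⟨h + h', fun τ ↦ ?_, fun τ hτ ↦ ?_⟩
    · rw [gelfandHat_add]; exact add_nonneg (h1 τ) (h1' τ)
    · rw [gelfandHat_add]
      rcases hτ with hτ | hτ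
      · exact (add_pos_of_pos_of_nonneg ((h1 τ).lt_of_ne' (h2 τ hτ)) (h1' τ)).ne'
      · exact (add_pos_of_nonneg_of_pos (h1 τ) ((h1' τ).lt_of_ne' (h2' τ hτ))).ne'
  -- Some `a` has `τ a ≠ 0`; then `star a * a` works near `τ`. Finitely many such elements can be
  -- added because nonnegative transforms cannot cancel.
  · intro τ _
    obtain ⟨a, ha⟩ : ∃ a, τ.toLin a ≠ 0 := by
      by_contra! h
      exact τ.ne_zero (LinearMap.ext h)
    refine ⟨{σ | gelfandHat (star a * a) σ ≠ 0}, mem_nhdsWithin_of_mem_nhds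
      ((isOpen_ne_fun (continuous_gelfandHat _) continuous_const).mem_nhds ?_),
      star a * a, fun σ ↦ ?_, fun σ hσ ↦ hσ⟩
    · change gelfandHat (star a * a) τ ≠ 0
      rw [gelfandHat_star_mul_self]
      exact Complex.ofReal_ne_zero.2 (pow_ne_zero 2 (norm_ne_zero_iff.2 ha))
    · rw [gelfandHat_star_mul_self]
      exact Complex.zero_le_real.2 (by positivity)

/-- The elements `1 - (1 - h) ^ n`, written without a unit. -/
def approxUnit {A : Type*} [NonUnitalNormedCommRing A] (h : A) : ℕ → A
  | 0 => 0
  | n + 1 => approxUnit h n + (h - h * approxUnit h n)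

omit [StarModule ℂ A] in
lemma gelfandHat_approxUnit (h : A) (n : ℕ) (τ : BsaCharacter A) :
    gelfandHat (approxUnit h n) τ = 1 - (1 - gelfandHat h τ) ^ n := by
  induction n with
  | zero => simp [approxUnit, gelfandHat_zero]
  | succ n ih =>
    rw [approxUnit, gelfandHat_add, gelfandHat_sub, gelfandHat_mul, ih]
    ring

/-- Scale a transform that is nonnegative, and nonzero on `K`, to `r` with values in `[0, 1]`. The
elements `g n` have transforms `1 - (1 - r) ^ n`, tending to the indicator of `{r ≠ 0} ⊇ K`. As
these lie in `[0, 1]`, their squares are no larger, and the variation bound gives `m² ≤ v m` in the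
limit, with `m = μ {r ≠ 0}`. -/
lemma measureReal_le_of_mem_variationBounds (μ : Measure (BsaCharacter A)) [IsProbabilityMeasure μ]
    {v : ℝ} (hv : v ∈ variationBounds (integralFunctional μ)) {K : Set (BsaCharacter A)}
    (hK : IsCompact K) : μ.real K ≤ v := by
  obtain ⟨h, hpos, hne⟩ := exists_gelfandHat_pos_on_compact hK
  set M : ℝ := √‖star h * h‖ + 1 with hM
  have hM0 : 0 < M := by positivity
  set r : BsaCharacter A → ℝ := fun τ ↦ (gelfandHat h τ).re / M with hr
  have hre (τ) : gelfandHat h τ = ((gelfandHat h τ).re : ℂ) :=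
    Complex.ext rfl (Complex.nonneg_iff.1 (hpos τ)).2.symm
  have hrc : Continuous r := by
    have := continuous_gelfandHat h
    fun_prop
  have hr0 (τ) : 0 ≤ r τ := div_nonneg (Complex.nonneg_iff.1 (hpos τ)).1 hM0.le
  have hr1 (τ) : r τ ≤ 1 := by
    refine (div_le_one hM0).2 ?_
    linarith [(Complex.re_le_norm _).trans (norm_gelfandHat_le h τ)]
  let g (n : ℕ) : A := approxUnit (((M⁻¹ : ℝ) : ℂ) • h) n
  have hg (n : ℕ) (τ) : gelfandHat (g n) τ = ((1 - (1 - r τ) ^ n : ℝ) : ℂ) := by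
    rw [gelfandHat_approxUnit, gelfandHat_smul, hre, hr]
    push_cast
    ring
  have hq0 (n : ℕ) (τ) : 0 ≤ (1 - r τ) ^ n := pow_nonneg (by linarith [hr1 τ]) n
  have hq1 (n : ℕ) (τ) : (1 - r τ) ^ n ≤ 1 :=
    pow_le_one₀ (by linarith [hr1 τ]) (by linarith [hr0 τ])
  have hqi (n : ℕ) : Integrable (fun τ ↦ (1 - r τ) ^ n) μ :=
    .of_bound (by fun_prop : Continuous _).aestronglyMeasurable 1 (.of_forall fun τ ↦ by
      rw [Real.norm_of_nonneg (hq0 n τ)]; exact hq1 n τ)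
  set p : ℕ → ℝ := fun n ↦ ∫ τ, (1 - r τ) ^ n ∂μ with hp
  have hint (n : ℕ) : ∫ τ, (1 - (1 - r τ) ^ n) ∂μ = 1 - p n := by
    rw [integral_sub (integrable_const _) (hqi n), integral_const, probReal_univ, one_smul]
  have key (n : ℕ) : (1 - p n) ^ 2 ≤ v * (1 - p n) := by
    have h1 := hv.2 (g n)
    have h2 : integralFunctional μ (g n) = ((1 - p n : ℝ) : ℂ) := by
      rw [integralFunctional_apply, ← hint, ← integral_complex_ofReal]
      exact integral_congr_ae (.of_forall (hg n))
    rw [h2, Complex.norm_real, Real.norm_eq_abs, sq_abs, integralFunctional_star_mul_self,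
      Complex.ofReal_re] at h1
    refine h1.trans (mul_le_mul_of_nonneg_left ?_ hv.1)
    rw [← hint]
    refine integral_mono_of_nonneg (.of_forall fun τ ↦ by positivity)
      ((integrable_const _).sub (hqi n)) (.of_forall fun τ ↦ ?_)
    simp only [hg, Complex.norm_real, Real.norm_eq_abs, sq_abs]
    nlinarith [hq0 n τ, hq1 n τ]
  let Z : Set (BsaCharacter A) := {τ | r τ = 0}
  have hZ : MeasurableSet Z := (isClosed_eq hrc continuous_const).measurableSet
  have hlim : Tendsto p atTop (𝓝 (μ.real Z)) := by
    rw [← integral_indicator_one hZ]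
    refine tendsto_integral_of_dominated_convergence (fun _ ↦ 1)
      (fun n ↦ (hqi n).aestronglyMeasurable) (integrable_const _)
      (fun n ↦ .of_forall fun τ ↦ ?_) (.of_forall fun τ ↦ ?_)
    · rw [Real.norm_of_nonneg (hq0 n τ)]; exact hq1 n τ
    · by_cases hτ : τ ∈ Z
      · have : r τ = 0 := hτ
        simp [Set.indicator_of_mem hτ, this]
      · rw [Set.indicator_of_notMem hτ]
        exact tendsto_pow_atTop_nhds_zero_of_lt_one (by linarith [hr1 τ])
          (by linarith [(hr0 τ).lt_of_ne' hτ])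
  have hfin : (1 - μ.real Z) ^ 2 ≤ v * (1 - μ.real Z) :=
    le_of_tendsto_of_tendsto' ((hlim.const_sub 1).pow 2) ((hlim.const_sub 1).const_mul v) key
  have hKZ : μ.real K ≤ 1 - μ.real Z := by
    rw [← probReal_compl_eq_one_sub hZ]
    refine measureReal_mono fun τ hτ h0 ↦ hne τ hτ ?_
    have h0 : r τ = 0 := h0
    rw [hre, (div_eq_zero_iff.1 h0).resolve_right hM0.ne', Complex.ofReal_zero]
  refine hKZ.trans ?_
  rcases (measureReal_nonneg.trans hKZ).eq_or_lt with h0 | h0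
  · rw [← h0]; exact hv.1
  · rw [sq] at hfin
    exact le_of_mul_le_mul_right hfin h0

/-- Inner regularity excludes a bound `v < 1`: some compact set would have measure greater than `v`.
-/
lemma integralFunctional_mem_states (μ : Measure (BsaCharacter A)) [IsProbabilityMeasure μ]
    [μ.InnerRegular] : integralFunctional μ ∈ States A := by
  refine ⟨isPositive_integralFunctional μ, isWeaklyContinuousOnSA_integralFunctional μ,
    ⟨1, one_mem_variationBounds μ⟩, le_antisymm
      (csInf_le ⟨0, fun v hv ↦ hv.1⟩ (one_mem_variationBounds μ))
      (le_csInf ⟨1, one_mem_variationBounds μ⟩ fun v hv ↦ ?_)⟩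
  by_contra! h
  obtain ⟨K, -, hK, hlt⟩ := Measure.InnerRegular.innerRegular (μ := μ) MeasurableSet.univ
    (ENNReal.ofReal v) (by rw [measure_univ]; exact ENNReal.ofReal_lt_one.2 h)
  refine absurd (measureReal_le_of_mem_variationBounds μ hv hK) (not_le.2 ?_)
  exact (ENNReal.ofReal_lt_iff_lt_toReal hv.1 (measure_ne_top _ _)).1 hlt

end

end AbstractBochner

/-! ### Uniqueness of the measure, and the affine bijection. -/

namespace AbstractBochner

open scoped CompactlySupported
open Complex Filter Topology

lemma continuous_integral_continuousMap {X : Type*} [TopologicalSpace X] [CompactSpace X]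
    [MeasurableSpace X] [BorelSpace X] (ν : Measure X) [IsFiniteMeasure ν] :
    Continuous fun f : C(X, ℂ) ↦ ∫ x, f x ∂ν := by
  have hint (f : C(X, ℂ)) : Integrable f ν :=
    f.continuous.integrable_of_hasCompactSupport (HasCompactSupport.of_compactSpace _)
  refine (LipschitzWith.of_dist_le_mul (K := ⟨ν.real Set.univ, measureReal_nonneg⟩)
    fun f g ↦ ?_).continuous
  rw [dist_eq_norm, ← integral_sub (hint f) (hint g), dist_eq_norm, mul_comm]
  exact norm_integral_le_of_norm_le_const (.of_forall (f - g).norm_coe_le_norm)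

section

variable {A : Type*} [NonUnitalNormedCommRing A] [StarRing A] [NormedSpace ℂ A]

/-- A product of closed discs, in which the characters of `A` embed. -/
abbrev DiscProduct (A : Type*) [NonUnitalNormedCommRing A] [StarRing A] : Type _ :=
  (a : selfAdjoint A) → Metric.closedBall (0 : ℂ) ‖(a : A)‖

instance : CompactSpace (DiscProduct A) :=
  have (a : selfAdjoint A) : CompactSpace (Metric.closedBall (0 : ℂ) ‖(a : A)‖) :=
    isCompact_iff_compactSpace.1 (isCompact_closedBall _ _)
  inferInstance

noncomputable instance : MeasurableSpace (DiscProduct A) := borel _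

instance : BorelSpace (DiscProduct A) := ⟨rfl⟩

/-- The embedding of the characters into a product of closed discs. -/
def toDiscProduct (τ : BsaCharacter A) : DiscProduct A := fun a ↦
  ⟨gelfandHat (a : A) τ, by
    rw [mem_closedBall_zero_iff]
    exact norm_gelfandHat_le_of_isSelfAdjoint a.2 τ⟩

lemma continuous_toDiscProduct : Continuous (toDiscProduct (A := A)) :=
  continuous_pi fun a ↦ (continuous_gelfandHat_of_isSelfAdjoint a.2).subtype_mk _

lemma isInducing_toDiscProduct : IsInducing (toDiscProduct (A := A)) :=
  IsInducing.of_comp (g := fun (y : DiscProduct A) (a : selfAdjoint A) ↦ (y a : ℂ))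
    continuous_toDiscProduct (by fun_prop) ⟨rfl⟩

/-- The Borel sets of an induced topology are the preimages of Borel sets, so the image of the
characters need not be measurable. -/
lemma exists_measurableSet_preimage_toDiscProduct {s : Set (BsaCharacter A)}
    (hs : MeasurableSet s) : ∃ t, MeasurableSet t ∧ toDiscProduct ⁻¹' t = s := by
  have h : BsaCharacter.instMeasurableSpace A = (borel (DiscProduct A)).comap toDiscProduct := by
    rw [← borel_comap, ← isInducing_toDiscProduct.eq_induced]
    rfl
  rw [h] at hs
  exact hs

/-- The continuous functions on the product of discs that restrict on the characters to a Gelfand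
transform plus a constant. -/
def gelfandSubalgebra [IsScalarTower ℂ A A] [SMulCommClass ℂ A A] :
    StarSubalgebra ℂ C(DiscProduct A, ℂ) where
  carrier := {f | ∃ (a : A) (c : ℂ), ∀ τ, f (toDiscProduct τ) = gelfandHat a τ + c}
  mul_mem' := by
    rintro f g ⟨a, c, hf⟩ ⟨b, d, hg⟩
    refine ⟨a * b + d • a + c • b, c * d, fun τ ↦ ?_⟩
    rw [ContinuousMap.mul_apply, hf, hg, gelfandHat_add, gelfandHat_add, gelfandHat_mul,
      gelfandHat_smul, gelfandHat_smul]
    ring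
  add_mem' := by
    rintro f g ⟨a, c, hf⟩ ⟨b, d, hg⟩
    refine ⟨a + b, c + d, fun τ ↦ ?_⟩
    rw [ContinuousMap.add_apply, hf, hg, gelfandHat_add]
    ring
  algebraMap_mem' c := ⟨0, c, fun τ ↦ by rw [gelfandHat_zero, zero_add]; rfl⟩
  star_mem' := by
    rintro f ⟨a, c, hf⟩
    refine ⟨star a, star c, fun τ ↦ ?_⟩
    rw [ContinuousMap.star_apply, hf, gelfandHat_star, star_add]

variable [IsScalarTower ℂ A A] [SMulCommClass ℂ A A]

/-- The coordinate functions belong to the subalgebra and separate all points of the product,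
including those that come from no character. -/
lemma topologicalClosure_gelfandSubalgebra :
    (gelfandSubalgebra (A := A)).topologicalClosure = ⊤ := by
  refine ContinuousMap.starSubalgebra_topologicalClosure_eq_top_of_separatesPoints _
    fun y z hyz ↦ ?_
  obtain ⟨a, ha⟩ := Function.ne_iff.1 hyz
  refine ⟨_, ⟨⟨fun y ↦ (y a : ℂ), by fun_prop⟩, ⟨(a : A), 0, fun τ ↦ ?_⟩, rfl⟩, ?_⟩
  · rw [add_zero]; rfl
  · exact fun h ↦ ha (Subtype.ext h)

variable [StarModule ℂ A]

/-- An inner regular probability measure on the characters is determined by the integrals of the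
Gelfand transforms. -/
theorem measure_ext_of_integral_gelfandHat (μ₁ μ₂ : Measure (BsaCharacter A))
    [IsProbabilityMeasure μ₁] [IsProbabilityMeasure μ₂] [μ₁.InnerRegular] [μ₂.InnerRegular]
    (h : ∀ a, ∫ τ, gelfandHat a τ ∂μ₁ = ∫ τ, gelfandHat a τ ∂μ₂) : μ₁ = μ₂ := by
  have hi := continuous_toDiscProduct (A := A)
  have hr₁ : (μ₁.map toDiscProduct).InnerRegular := .map_of_continuous hi
  have hr₂ : (μ₂.map toDiscProduct).InnerRegular := .map_of_continuous hi
  have hmap : ∀ f : C(DiscProduct A, ℂ),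
      ∫ y, f y ∂(μ₁.map toDiscProduct) = ∫ y, f y ∂(μ₂.map toDiscProduct) := by
    -- The pushforwards see only values on characters, where `f` is a Gelfand transform plus a
    -- constant; the constants agree because both masses are `1`.
    have hsub : ∀ f ∈ (gelfandSubalgebra (A := A)),
        ∫ y, f y ∂(μ₁.map toDiscProduct) = ∫ y, f y ∂(μ₂.map toDiscProduct) := by
      rintro f ⟨a, c, hf⟩
      rw [integral_map hi.aemeasurable f.continuous.aestronglyMeasurable,
        integral_map hi.aemeasurable f.continuous.aestronglyMeasurable]
      simp_rw [hf]
      rw [integral_add (integrable_gelfandHat μ₁ a) (integrable_const c),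
        integral_add (integrable_gelfandHat μ₂ a) (integrable_const c), h, integral_const,
        integral_const, probReal_univ, probReal_univ]
    intro f
    have hmem : f ∈ (gelfandSubalgebra (A := A)).topologicalClosure := by
      rw [topologicalClosure_gelfandSubalgebra]; trivial
    exact closure_minimal (t := {f : C(DiscProduct A, ℂ) |
      ∫ y, f y ∂(μ₁.map toDiscProduct) = ∫ y, f y ∂(μ₂.map toDiscProduct)}) hsub
      (isClosed_eq (continuous_integral_continuousMap _) (continuous_integral_continuousMap _)) hmem
  have heq : μ₁.map toDiscProduct = μ₂.map toDiscProduct := by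
    refine Measure.ext_of_integral_eq_on_compactlySupported fun f ↦ ?_
    have := hmap ⟨fun y ↦ (f y : ℂ), by fun_prop⟩
    simp only [ContinuousMap.coe_mk, integral_complex_ofReal] at this
    exact_mod_cast this
  ext s hs
  obtain ⟨t, ht, rfl⟩ := exists_measurableSet_preimage_toDiscProduct hs
  rw [← Measure.map_apply hi.measurable ht, heq, Measure.map_apply hi.measurable ht]

instance (μ : M₁ (BsaCharacter A)) : IsProbabilityMeasure (μ : Measure (BsaCharacter A)) := μ.2.1

instance (μ : M₁ (BsaCharacter A)) : (μ : Measure (BsaCharacter A)).InnerRegular := μ.2.2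

/-- The bijection between inner regular probability measures on the characters and states. -/
noncomputable def measureEquivStates : M₁ (BsaCharacter A) ≃ States A :=
  Equiv.ofBijective
    (fun μ ↦ ⟨integralFunctional (μ : Measure (BsaCharacter A)), integralFunctional_mem_states _⟩)
    ⟨fun μ₁ μ₂ h ↦ Subtype.ext (measure_ext_of_integral_gelfandHat _ _ fun a ↦
      LinearMap.congr_fun (congrArg Subtype.val h) a), fun φ ↦ by
      obtain ⟨μ, hμ, h⟩ := exists_measure_of_mem_states φ.2
      exact ⟨⟨μ, hμ⟩, Subtype.ext (LinearMap.ext fun a ↦ (h a).symm)⟩⟩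

lemma measureEquivStates_apply (μ : M₁ (BsaCharacter A)) (a : A) :
    (measureEquivStates μ : A →ₗ[ℂ] ℂ) a =
      ∫ τ, gelfandHat a τ ∂(μ : Measure (BsaCharacter A)) := rfl

end

lemma convexComb_mem_M₁ {Ω : Type*} [TopologicalSpace Ω] [MeasurableSpace Ω] (μ₁ μ₂ : M₁ Ω)
    {s t : ℝ≥0} (hst : s + t = 1) :
    s • (μ₁ : Measure Ω) + t • (μ₂ : Measure Ω) ∈ M₁ Ω := by
  have := μ₁.2.1
  have := μ₂.2.1
  have := μ₁.2.2
  have := μ₂.2.2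
  refine ⟨⟨?_⟩, inferInstance⟩
  simp only [Measure.add_apply, Measure.smul_apply, measure_univ, ENNReal.smul_def, smul_eq_mul,
    mul_one]
  exact_mod_cast hst

end AbstractBochner

theorem mainTheorem7 (A : Type*) [NonUnitalNormedCommRing A] [StarRing A] [NormedSpace ℂ A]
    [IsScalarTower ℂ A A] [SMulCommClass ℂ A A] [StarModule ℂ A] :
    ∃ Φ : AbstractBochner.M₁ (AbstractBochner.BsaCharacter A) ≃ AbstractBochner.States A,
      (∀ (μ : AbstractBochner.M₁ (AbstractBochner.BsaCharacter A)) (a : A),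
        Integrable (AbstractBochner.gelfandHat a) (μ : Measure (AbstractBochner.BsaCharacter A)) ∧
        (Φ μ : A →ₗ[ℂ] ℂ) a =
          ∫ τ, AbstractBochner.gelfandHat a τ ∂(μ : Measure (AbstractBochner.BsaCharacter A))) ∧
      (∀ (μ₁ μ₂ : AbstractBochner.M₁ (AbstractBochner.BsaCharacter A)) (s t : ℝ≥0), s + t = 1 →
        ∃ μ : AbstractBochner.M₁ (AbstractBochner.BsaCharacter A),
          (μ : Measure (AbstractBochner.BsaCharacter A)) =
            s • (μ₁ : Measure (AbstractBochner.BsaCharacter A)) +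
              t • (μ₂ : Measure (AbstractBochner.BsaCharacter A)) ∧
          (Φ μ : A →ₗ[ℂ] ℂ) =
            ((s : ℝ) : ℂ) • (Φ μ₁ : A →ₗ[ℂ] ℂ) + ((t : ℝ) : ℂ) • (Φ μ₂ : A →ₗ[ℂ] ℂ)) := by
  refine ⟨AbstractBochner.measureEquivStates, fun μ a ↦
    ⟨AbstractBochner.integrable_gelfandHat _ a, AbstractBochner.measureEquivStates_apply μ a⟩,
    fun μ₁ μ₂ s t hst ↦ ⟨⟨_, AbstractBochner.convexComb_mem_M₁ μ₁ μ₂ hst⟩, rfl, ?_⟩⟩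
  ext a
  have h₁ := AbstractBochner.integrable_gelfandHat
    (μ₁ : Measure (AbstractBochner.BsaCharacter A)) a
  have h₂ := AbstractBochner.integrable_gelfandHat
    (μ₂ : Measure (AbstractBochner.BsaCharacter A)) a
  rw [LinearMap.add_apply, LinearMap.smul_apply, LinearMap.smul_apply,
    AbstractBochner.measureEquivStates_apply, AbstractBochner.measureEquivStates_apply,
    AbstractBochner.measureEquivStates_apply,
    integral_add_measure h₁.smul_measure_nnreal h₂.smul_measure_nnreal,
    integral_smul_nnreal_measure, integral_smul_nnreal_measure]
  rfl
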